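/- **Spectral Quantization.** Let $U\subseteq\mathbb C$ be an open set of frequencies and let $\Psi''+P(z;\omega)\Psi'+Q(z;\omega)\Psi=0$, $0<z<1$, $\omega\in U$, be a family of radial equations in the non-resonant hypergeometric class: there are exponents $\rho_0(\omega),\rho_1(\omega)\in\mathbb C$ and analytic functions $a,b,c$ on $U$, with $c(\omega)\notin\{0,-1,-2,\dots\}$ and $c(\omega)-a(\omega)-b(\omega)\notin\mathbb Z$ for all $\omega\in U$, such that $\Psi=z^{\rho_0}(1-z)^{\rho_1}f$ solves the radial equation if and only if $f$ solves the Gauss equation $z(1-z)f''+[c-(a+b+1)z]f'-ab\,f=0$ on $(0,1)$. Put $$R_{\rm in}=z^{\rho_0}(1-z)^{\rho_1}{}_2F_1(a,b;c;z),\qquad R_{\rm slow}=z^{\rho_0}(1-z)^{\rho_1}{}_2F_1(a,b;a+b-c+1;1-z),$$ $$R_{\rm fast}=z^{\rho_0}(1-z)^{\rho_1+c-a-b}{}_2F_1(c-a,c-b;c-a-b+1;1-z).$$ Then, for every $\omega\in U$, $R_{\rm in}$ solves the radial equation, and every solution $R$ of the radial equation has exactly one expansion $R=\mathsf c_{\rm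 slow}(R)\,R_{\rm slow}+\mathsf c_{\rm fast}(R)\,R_{\rm fast}$ near $z=1$ with constants $\mathsf c_{\rm slow}(R),\mathsf c_{\rm fast}(R)\in\mathbb C$. Let $(\alpha,\beta)\in\mathbb C^2\setminus\{(0,0)\}$ and $\mathcal B_{\alpha,\beta}[R]:=\alpha\,\mathsf c_{\rm slow}(R)+\beta\,\mathsf c_{\rm fast}(R)$, and call $\omega\in U$ a quasinormal frequency if $\mathcal B_{\alpha,\beta}[R_{\rm in}(\cdot;\omega)]=0$. Then the quasinormal frequencies in $U$ are exactly the zeros in $U$ of $$F_{\alpha,\beta}(\omega)=\alpha\,\frac{\Gamma(c)\Gamma(c-a-b)}{\Gamma(c-a)\Gamma(c-b)}+\beta\,\frac{\Gamma(c)\Gamma(a+b-c)}{\Gamma(a)\Gamma(b)},$$ where $1/\Gamma$ is the entire reciprocal Gamma function (zero at $0,-1,-2,\dots$). -/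

import Mathlib

open Set Filter Topology

/-- `f` is twice differentiable on `(0,1)` and solves there the Gauss hypergeometric equation
`z (1 - z) f'' + (c - (a + b + 1) z) f' - a b f = 0`. -/
def IsHypergeometricSolution (a b c : ℂ) (f : ℝ → ℂ) : Prop :=
  ∀ z ∈ Ioo (0 : ℝ) 1, DifferentiableAt ℝ f z ∧ DifferentiableAt ℝ (deriv f) z ∧
    (z : ℂ) * (1 - z) * deriv (deriv f) z + (c - (a + b + 1) * z) * deriv f z - a * b * f z = 0

/-- `Ψ` is twice differentiable on `(0,1)` and solves there `Ψ'' + P Ψ' + Q Ψ = 0`. -/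
def IsRadialSolution (P Q : ℝ → ℂ) (Ψ : ℝ → ℂ) : Prop :=
  ∀ z ∈ Ioo (0 : ℝ) 1, DifferentiableAt ℝ Ψ z ∧ DifferentiableAt ℝ (deriv Ψ) z ∧
    deriv (deriv Ψ) z + P z * deriv Ψ z + Q z * Ψ z = 0

/-- A family, indexed by the frequency `ω ∈ U`, of radial equations `Ψ'' + P Ψ' + Q Ψ = 0` on
`(0,1)` in the non-resonant hypergeometric spectral class: after the exponents `ρ₀` at `z = 0` and
`ρ₁` at `z = 1` are factored out, the equation for the residual function is the Gauss
hypergeometric equation with parameters `a ω`, `b ω`, `c ω`.  (This determines `P` and `Q` on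
`(0,1)`; in particular both endpoints are then at worst regular singular points, with `ρ₀` and
`ρ₁` among their indicial exponents.) -/
structure HypergeometricSpectralProblem (U : Set ℂ) where
  /-- coefficient of `Ψ'` -/
  P : ℂ → ℝ → ℂ
  /-- coefficient of `Ψ` -/
  Q : ℂ → ℝ → ℂ
  /-- ingoing exponent at `z = 0` -/
  ρ₀ : ℂ → ℂ
  /-- slow exponent at `z = 1` -/
  ρ₁ : ℂ → ℂ
  /-- first upper hypergeometric parameter -/
  a : ℂ → ℂ
  /-- second upper hypergeometric parameter -/
  b : ℂ → ℂ
  /-- lower hypergeometric parameter -/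
  c : ℂ → ℂ
  isOpen_domain : IsOpen U
  analytic_a : AnalyticOnNhd ℂ a U
  analytic_b : AnalyticOnNhd ℂ b U
  analytic_c : AnalyticOnNhd ℂ c U
  /-- `₂F₁(a, b; c; ·)` is defined -/
  c_ne_neg_nat : ∀ ω ∈ U, ∀ n : ℕ, c ω ≠ -(n : ℂ)
  /-- non-resonance -/
  nonresonant : ∀ ω ∈ U, ∀ n : ℤ, c ω - a ω - b ω ≠ (n : ℂ)
  /-- `Ψ = z ^ ρ₀ (1 - z) ^ ρ₁ f` solves the radial equation exactly when `f` solves the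
  hypergeometric equation -/
  reduces : ∀ ω ∈ U, ∀ f : ℝ → ℂ,
    IsRadialSolution (P ω) (Q ω) (fun z => (z : ℂ) ^ ρ₀ ω * (1 - (z : ℂ)) ^ ρ₁ ω * f z) ↔
      IsHypergeometricSolution (a ω) (b ω) (c ω) f

namespace HypergeometricSpectralProblem

/-- The ingoing solution. -/
noncomputable def Rin {U : Set ℂ} (S : HypergeometricSpectralProblem U) (ω : ℂ) (z : ℝ) : ℂ :=
  (z : ℂ) ^ S.ρ₀ ω * (1 - (z : ℂ)) ^ S.ρ₁ ω *
    ordinaryHypergeometric (S.a ω) (S.b ω) (S.c ω) (z : ℂ)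

/-- The slow basis solution at `z = 1`. -/
noncomputable def Rslow {U : Set ℂ} (S : HypergeometricSpectralProblem U) (ω : ℂ) (z : ℝ) : ℂ :=
  (z : ℂ) ^ S.ρ₀ ω * (1 - (z : ℂ)) ^ S.ρ₁ ω *
    ordinaryHypergeometric (S.a ω) (S.b ω) (S.a ω + S.b ω - S.c ω + 1) (1 - (z : ℂ))

/-- The fast basis solution at `z = 1`. -/
noncomputable def Rfast {U : Set ℂ} (S : HypergeometricSpectralProblem U) (ω : ℂ) (z : ℝ) : ℂ :=
  (z : ℂ) ^ S.ρ₀ ω * (1 - (z : ℂ)) ^ (S.ρ₁ ω + S.c ω - S.a ω - S.b ω) *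
    ordinaryHypergeometric (S.c ω - S.a ω) (S.c ω - S.b ω) (S.c ω - S.a ω - S.b ω + 1)
      (1 - (z : ℂ))

/-- `R = k.1 * Rslow + k.2 * Rfast` near the boundary `z = 1`. -/
def HasBoundaryExpansion {U : Set ℂ} (S : HypergeometricSpectralProblem U) (ω : ℂ) (R : ℝ → ℂ)
    (k : ℂ × ℂ) : Prop :=
  ∀ᶠ z in 𝓝[<] (1 : ℝ), R z = k.1 * S.Rslow ω z + k.2 * S.Rfast ω z

/-- The pair of coefficients `(c_slow(R), c_fast(R))` of the expansion of `R` at `z = 1`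
(meaningful when there is exactly one such pair, as for every solution of the radial equation). -/
noncomputable def boundaryCoeffs {U : Set ℂ} (S : HypergeometricSpectralProblem U) (ω : ℂ)
    (R : ℝ → ℂ) : ℂ × ℂ :=
  Classical.epsilon (S.HasBoundaryExpansion ω R)

/-- The boundary functional `α c_slow(R) + β c_fast(R)`. -/
noncomputable def boundaryFunctional {U : Set ℂ} (S : HypergeometricSpectralProblem U) (α β : ℂ)
    (ω : ℂ) (R : ℝ → ℂ) : ℂ :=
  α * (S.boundaryCoeffs ω R).1 + β * (S.boundaryCoeffs ω R).2

/-- The quasinormal frequencies: those at which the ingoing solution satisfies the boundary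
condition at `z = 1`. -/
def quasinormalFrequencies {U : Set ℂ} (S : HypergeometricSpectralProblem U) (α β : ℂ) : Set ℂ :=
  {ω | ω ∈ U ∧ S.boundaryFunctional α β ω (S.Rin ω) = 0}

/-- The slow connection coefficient.  Mathlib's `Complex.Gamma` is `0` at its poles, so that
a pole in the denominator gives the value `0`, as the entire function `1 / Γ` requires. -/
noncomputable def Cslow {U : Set ℂ} (S : HypergeometricSpectralProblem U) (ω : ℂ) : ℂ :=
  Complex.Gamma (S.c ω) * Complex.Gamma (S.c ω - S.a ω - S.b ω) /
    (Complex.Gamma (S.c ω - S.a ω) * Complex.Gamma (S.c ω - S.b ω))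

/-- The fast connection coefficient (with the same convention). -/
noncomputable def Cfast {U : Set ℂ} (S : HypergeometricSpectralProblem U) (ω : ℂ) : ℂ :=
  Complex.Gamma (S.c ω) * Complex.Gamma (S.a ω + S.b ω - S.c ω) /
    (Complex.Gamma (S.a ω) * Complex.Gamma (S.b ω))

/-- The quantization function. -/
noncomputable def quantizationFunction {U : Set ℂ} (S : HypergeometricSpectralProblem U)
    (α β : ℂ) (ω : ℂ) : ℂ :=
  α * S.Cslow ω + β * S.Cfast ω

end HypergeometricSpectralProblem

/-! Removing the prefactor, which has no zero on $(0,1)$, turns everything into a statement about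
the Gauss equation: the coefficients of ${}_2F_1(a,b;c;z)$ in the slow/fast basis at $z=1$ are the
two Gamma quotients.

Existence and uniqueness of expansions come from Wronskians. By Abel's identity all Wronskians obey
the same first-order linear equation, so their quotients are constant; Cramer's rule gives the
coefficients once the slow/fast Wronskian is nonzero, which near $z=1$ follows from $c-a-b\ne0$.

The slow coefficient is found without integral representations. The operator $z\,d/dz+c$ lowers
$c+1$ to $c$ and maps ${}_2F_1$, the slow solution and the fast solution each to a multiple of its
counterpart (`HasGaussExpansion.contiguous`). This relates the coefficient at $c$ to the one at
$c+N$ by finite products, which are Euler's products for $\Gamma$. As $N\to\infty$,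
${}_2F_1(a,b;c+N;z)\to1$ uniformly on the disc, while for $\operatorname{Re}(c+N-a-b)>0$ the slow
coefficient is the limit at $z=1$; so it tends to $1$ (`HasGaussExpansion.fst_eq_Gamma`).

The fast coefficient is the slow one for $(c-a,c-b,c)$, since Euler's transformation exchanges the
two basis solutions (`HasGaussExpansion.swap`). -/

/-! ### Power series on the unit disc -/

/-- `f` is the sum of the power series with coefficients `u` on the open unit disc. -/
def HasDiscSum (u : ℕ → ℂ) (f : ℂ → ℂ) : Prop :=
  ∀ z : ℂ, ‖z‖ < 1 → HasSum (fun n => u n * z ^ n) (f z)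

namespace HasDiscSum

variable {u v : ℕ → ℂ} {f g : ℂ → ℂ}

theorem hasFPowerSeriesOnBall (h : HasDiscSum u f) :
    HasFPowerSeriesOnBall f (FormalMultilinearSeries.ofScalars ℂ u) 0 1 where
  r_le := by
    refine ENNReal.le_of_forall_nnreal_lt fun r hr => ?_
    have hr' : (r : ℝ) < 1 := by exact_mod_cast hr
    have hs := (h (r : ℝ) (by simpa using hr')).summable.norm
    refine FormalMultilinearSeries.le_radius_of_summable_norm _ ?_
    simpa [FormalMultilinearSeries.ofScalars_norm] using hs
  r_pos := one_pos
  hasSum := by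
    intro y hy
    have hy' : ‖y‖ < 1 := by
      rw [← ENNReal.ofReal_one, Metric.eball_ofReal] at hy
      simpa using hy
    simpa [FormalMultilinearSeries.ofScalars_apply_eq, mul_comm] using h y hy'

theorem of_hasFPowerSeriesOnBall {p : FormalMultilinearSeries ℂ ℂ ℂ}
    (h : HasFPowerSeriesOnBall f p 0 1) : HasDiscSum p.coeff f := by
  intro z hz
  have hz' : z ∈ Metric.eball (0 : ℂ) 1 := by
    rw [← ENNReal.ofReal_one, Metric.eball_ofReal]
    simpa using hz
  simpa [mul_comm] using h.hasSum hz'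

theorem analyticAt (h : HasDiscSum u f) {z : ℂ} (hz : ‖z‖ < 1) : AnalyticAt ℂ f z := by
  refine h.hasFPowerSeriesOnBall.analyticAt_of_mem ?_
  rw [← ENNReal.ofReal_one, Metric.eball_ofReal]
  simpa using hz

theorem congr_coeff (h : HasDiscSum u f) (huv : ∀ n, u n = v n) : HasDiscSum v f := by
  rwa [← funext huv]

theorem eq (h : HasDiscSum u f) (h' : HasDiscSum u g) {z : ℂ} (hz : ‖z‖ < 1) : f z = g z :=
  (h z hz).unique (h' z hz)

theorem deriv (h : HasDiscSum u f) :
    HasDiscSum (fun n => ((n : ℂ) + 1) * u (n + 1)) (deriv f) := by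
  have h1 := h.hasFPowerSeriesOnBall.fderiv
  have h2 := (ContinuousLinearMap.apply ℂ ℂ (1 : ℂ)).comp_hasFPowerSeriesOnBall h1
  refine (of_hasFPowerSeriesOnBall h2).congr_coeff fun n => ?_
  have := FormalMultilinearSeries.derivSeries_coeff_one (FormalMultilinearSeries.ofScalars ℂ u) n
  simp only [FormalMultilinearSeries.coeff_ofScalars, nsmul_eq_mul, Nat.cast_add,
    Nat.cast_one] at this
  rw [← this]
  rfl

theorem add (h : HasDiscSum u f) (h' : HasDiscSum v g) :
    HasDiscSum (fun n => u n + v n) (fun z => f z + g z) := fun z hz => by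
  simpa [add_mul] using (h z hz).add (h' z hz)

theorem sub (h : HasDiscSum u f) (h' : HasDiscSum v g) :
    HasDiscSum (fun n => u n - v n) (fun z => f z - g z) := fun z hz => by
  simpa [sub_mul] using (h z hz).sub (h' z hz)

theorem const_mul (h : HasDiscSum u f) (k : ℂ) :
    HasDiscSum (fun n => k * u n) (fun z => k * f z) := fun z hz => by
  simpa [mul_assoc] using (h z hz).mul_left k

theorem id_mul (h : HasDiscSum u f) :
    HasDiscSum (fun n => n.casesOn 0 u) (fun z => z * f z) := fun z hz => by
  have h1 := (h z hz).mul_left z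
  rw [← hasSum_nat_add_iff' 1]
  simpa [pow_succ, mul_comm, mul_left_comm, mul_assoc] using h1

/-- The Euler operator `z d/dz` multiplies the `n`-th coefficient by `n`. -/
theorem id_mul_deriv (h : HasDiscSum u f) :
    HasDiscSum (fun n => (n : ℂ) * u n) (fun z => z * _root_.deriv f z) :=
  h.deriv.id_mul.congr_coeff fun n => by cases n <;> simp

end HasDiscSum

/-! ### Hypergeometric coefficients and convergence -/

section Coefficient

variable {a b c : ℂ}

theorem ordinaryHypergeometricCoefficient_zero (a b c : ℂ) :
    ordinaryHypergeometricCoefficient a b c 0 = 1 := by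
  simp [ordinaryHypergeometricCoefficient]

theorem ordinaryHypergeometricCoefficient_succ {n : ℕ} (hc : c + n ≠ 0) :
    (n + 1) * (c + n) * ordinaryHypergeometricCoefficient a b c (n + 1) =
      (a + n) * (b + n) * ordinaryHypergeometricCoefficient a b c n := by
  have hn : (n : ℂ) + 1 ≠ 0 := by exact_mod_cast n.succ_ne_zero
  simp only [ordinaryHypergeometricCoefficient, ascPochhammer_succ_eval, Nat.factorial_succ,
    Nat.cast_mul, Nat.cast_add, Nat.cast_one, mul_inv]
  field_simp

theorem hasDiscSum_ordinaryHypergeometric (hc : ∀ n : ℕ, c ≠ -(n : ℂ)) :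
    HasDiscSum (ordinaryHypergeometricCoefficient a b c) (ordinaryHypergeometric a b c) := by
  -- The radius is exactly one only if neither $a$ nor $b$ is a nonpositive integer; otherwise the
  -- series terminates and the radius is infinite.
  have hr : 1 ≤ (ordinaryHypergeometricSeries ℂ a b c).radius := by
    by_cases ha : ∃ n : ℕ, a = -(n : ℂ)
    · obtain ⟨n, rfl⟩ := ha
      simp [ordinaryHypergeometric_radius_top_of_neg_nat₁]
    by_cases hb : ∃ n : ℕ, b = -(n : ℂ)
    · obtain ⟨n, rfl⟩ := hb
      simp [ordinaryHypergeometric_radius_top_of_neg_nat₂]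
    push Not at ha hb
    rw [ordinaryHypergeometricSeries_radius_eq_one]
    refine fun n => ⟨fun h => ha n ?_, fun h => hb n ?_, fun h => hc n ?_⟩ <;> simp [h]
  have h := HasDiscSum.of_hasFPowerSeriesOnBall
    (((ordinaryHypergeometricSeries ℂ a b c).hasFPowerSeriesOnBall
      (lt_of_lt_of_le one_pos hr)).mono one_pos hr)
  refine h.congr_coeff fun n => ?_
  simp [ordinaryHypergeometricSeries]

end Coefficient

/-! ### The Gauss equation and its symmetries -/

/-- `f` is analytic at `z` and satisfies there the Gauss hypergeometric equation. -/
def SolvesGaussAt (a b c : ℂ) (f : ℂ → ℂ) (z : ℂ) : Prop :=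
  AnalyticAt ℂ f z ∧
    z * (1 - z) * deriv (deriv f) z + (c - (a + b + 1) * z) * deriv f z - a * b * f z = 0

theorem solvesGaussAt_ordinaryHypergeometric {a b c z : ℂ} (hc : ∀ n : ℕ, c ≠ -(n : ℂ))
    (hz : ‖z‖ < 1) : SolvesGaussAt a b c (ordinaryHypergeometric a b c) z := by
  have h := hasDiscSum_ordinaryHypergeometric (a := a) (b := b) hc
  refine ⟨h.analyticAt hz, ?_⟩
  have h1 := h.deriv
  have h2 := h1.id_mul_deriv
  have h3 := ((h2.add (h1.const_mul c)).sub
    ((h2.id_mul.add (h.id_mul_deriv.const_mul (a + b + 1))).add (h.const_mul (a * b))))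
  -- The $n$-th coefficient of the left side of the equation is the two-term recursion, so it
  -- vanishes.
  have h4 := h3.congr_coeff (v := fun _ => 0) fun n => by
    have hn := ordinaryHypergeometricCoefficient_succ (a := a) (b := b) (c := c) (n := n)
      fun h0 => hc n (eq_neg_of_add_eq_zero_left h0)
    cases n with
    | zero =>
      simp only [Nat.cast_zero, Nat.rec_zero] at hn ⊢
      linear_combination hn
    | succ n =>
      push_cast at hn ⊢
      linear_combination hn
  have h5 := (h4 z hz).unique (by simp : HasSum (fun n : ℕ => 0 * z ^ n) 0)
  linear_combination h5

/-- The reflection $z\mapsto1-z$ exchanges the singular points $0$ and $1$; it produces the slow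
solution. -/
theorem SolvesGaussAt.comp_one_sub {a b c z : ℂ} {f : ℂ → ℂ}
    (h : SolvesGaussAt a b (a + b - c + 1) f (1 - z)) :
    SolvesGaussAt a b c (fun x => f (1 - x)) z := by
  obtain ⟨hf, he⟩ := h
  have h1 : (deriv fun x => f (1 - x)) = fun x => -deriv f (1 - x) := by
    funext x
    exact deriv_comp_const_sub f 1 x
  have h2 : deriv (fun x => -deriv f (1 - x)) z = deriv (deriv f) (1 - z) := by
    rw [deriv.fun_neg, deriv_comp_const_sub (deriv f) 1 z, neg_neg]
  refine ⟨AnalyticAt.fun_comp hf (by fun_prop), ?_⟩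
  rw [h1, h2]
  linear_combination he

theorem deriv_one_sub_cpow_mul {s z : ℂ} {g : ℂ → ℂ} (hg : DifferentiableAt ℂ g z)
    (hz : 1 - z ∈ Complex.slitPlane) :
    deriv (fun x => (1 - x) ^ s * g x) z = (1 - z) ^ s * (deriv g z - s * (1 - z)⁻¹ * g z) := by
  have h1 : HasDerivAt (fun x : ℂ => 1 - x) (-1) z := by
    simpa using (hasDerivAt_id z).const_sub 1
  rw [((h1.cpow_const (c := s) hz).fun_mul hg.hasDerivAt).deriv,
    Complex.cpow_sub _ _ (Complex.slitPlane_ne_zero hz), Complex.cpow_one]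
  ring

/-- The exponents at $z=1$ are $0$ and $c-a-b$; multiplying by this power exchanges their roles. It
yields both the fast solution and Euler's transformation. -/
theorem SolvesGaussAt.one_sub_cpow_mul {a b c z : ℂ} {g : ℂ → ℂ}
    (h : SolvesGaussAt (c - a) (c - b) c g z) (hz : 1 - z ∈ Complex.slitPlane) :
    SolvesGaussAt a b c (fun x => (1 - x) ^ (c - a - b) * g x) z := by
  obtain ⟨hg, he⟩ := h
  have hev : ∀ᶠ x in 𝓝 z, 1 - x ∈ Complex.slitPlane :=
    (continuous_const.sub continuous_id).continuousAt.eventually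
      (Complex.isOpen_slitPlane.mem_nhds hz)
  have h1 : deriv (fun x => (1 - x) ^ (c - a - b) * g x) =ᶠ[𝓝 z] fun x =>
      (1 - x) ^ (c - a - b) * (deriv g x - (c - a - b) * (1 - x)⁻¹ * g x) := by
    filter_upwards [hev, hg.eventually_analyticAt] with x hx hgx
    exact deriv_one_sub_cpow_mul hgx.differentiableAt hx
  have hw := Complex.slitPlane_ne_zero hz
  have h3 : HasDerivAt (fun x => deriv g x - (c - a - b) * (1 - x)⁻¹ * g x)
      (deriv (deriv g) z - ((c - a - b) * ((1 - z) ^ 2)⁻¹ * g z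
        + (c - a - b) * (1 - z)⁻¹ * deriv g z)) z := by
    have hi : HasDerivAt (fun x : ℂ => (1 - x)⁻¹) ((1 - z) ^ 2)⁻¹ z := by
      have := ((hasDerivAt_id z).const_sub 1).fun_inv hw
      simpa [div_eq_mul_inv] using this
    exact hg.deriv.differentiableAt.hasDerivAt.sub
      ((hi.const_mul _).mul hg.differentiableAt.hasDerivAt)
  refine ⟨?_, ?_⟩
  · exact AnalyticAt.mul (AnalyticAt.cpow (by fun_prop) analyticAt_const hz) hg
  rw [h1.deriv_eq, h1.self_of_nhds, deriv_one_sub_cpow_mul h3.differentiableAt hz, h3.deriv]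
  have key : z * (1 - z) * (deriv (deriv g) z - ((c - a - b) * ((1 - z) ^ 2)⁻¹ * g z
      + (c - a - b) * (1 - z)⁻¹ * deriv g z) - (c - a - b) * (1 - z)⁻¹ *
        (deriv g z - (c - a - b) * (1 - z)⁻¹ * g z)) + (c - (a + b + 1) * z) *
        (deriv g z - (c - a - b) * (1 - z)⁻¹ * g z) - a * b * g z = 0 := by
    field_simp
    linear_combination (1 - z) * he
  linear_combination (1 - z) ^ (c - a - b) * key

theorem SolvesGaussAt.isHypergeometricSolution {a b c : ℂ} {f : ℂ → ℂ}
    (h : ∀ x ∈ Ioo (0 : ℝ) 1, SolvesGaussAt a b c f x) :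
    IsHypergeometricSolution a b c fun x => f x := by
  intro x hx
  have hd : (deriv fun t : ℝ => f t) =ᶠ[𝓝 x] fun t : ℝ => deriv f t := by
    filter_upwards [isOpen_Ioo.mem_nhds hx] with t ht
    exact (h t ht).1.differentiableAt.hasDerivAt.comp_ofReal.deriv
  have h2 := (h x hx).1.deriv.differentiableAt.hasDerivAt.comp_ofReal
  refine ⟨(h x hx).1.differentiableAt.hasDerivAt.comp_ofReal.differentiableAt,
    (h2.congr_of_eventuallyEq hd).differentiableAt, ?_⟩
  rw [hd.deriv_eq, h2.deriv, hd.self_of_nhds]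
  exact (h x hx).2

/-! ### Contiguity: the action of $z\,d/dz+c$ -/

section Contiguity

variable {a b c : ℂ}

theorem ordinaryHypergeometricCoefficient_lower_add_one {n : ℕ} (hc : ∀ n : ℕ, c ≠ -(n : ℂ)) :
    c * ordinaryHypergeometricCoefficient a b c n =
      (c + n) * ordinaryHypergeometricCoefficient a b (c + 1) n := by
  have h0 : ∀ n : ℕ, c + n ≠ 0 := fun n h => hc n (eq_neg_of_add_eq_zero_left h)
  have hz : (ascPochhammer ℂ n).eval c ≠ 0 := by
    rw [Ne, ascPochhammer_eval_eq_zero_iff]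
    rintro ⟨k, -, hk⟩
    exact h0 k (by rw [hk]; ring)
  have hz' : (ascPochhammer ℂ n).eval (c + 1) ≠ 0 := by
    rw [Ne, ascPochhammer_eval_eq_zero_iff]
    rintro ⟨k, -, hk⟩
    exact h0 (k + 1) (by push_cast; rw [hk]; ring)
  have h : c * (ascPochhammer ℂ n).eval (c + 1) = (ascPochhammer ℂ n).eval c * (c + n) := by
    rw [← ascPochhammer_succ_eval, ascPochhammer_succ_left]
    simp
  have h' : c * ((ascPochhammer ℂ n).eval c)⁻¹ =
      (c + n) * ((ascPochhammer ℂ n).eval (c + 1))⁻¹ := by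
    field_simp
    linear_combination h
  simp only [ordinaryHypergeometricCoefficient]
  linear_combination
    (n.factorial : ℂ)⁻¹ * (ascPochhammer ℂ n).eval a * (ascPochhammer ℂ n).eval b * h'

theorem ordinaryHypergeometricCoefficient_add_one (hc : ∀ n : ℕ, c ≠ -(n : ℂ)) (n : ℕ) :
    (n + 1) * c * ordinaryHypergeometricCoefficient a b c (n + 1) =
      a * b * ordinaryHypergeometricCoefficient (a + 1) (b + 1) (c + 1) n := by
  have hc0 : c ≠ 0 := by simpa using hc 0
  have hn : (n : ℂ) + 1 ≠ 0 := by exact_mod_cast n.succ_ne_zero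
  have h : ∀ x : ℂ, (ascPochhammer ℂ (n + 1)).eval x = x * (ascPochhammer ℂ n).eval (x + 1) :=
    fun x => by rw [ascPochhammer_succ_left]; simp
  simp only [ordinaryHypergeometricCoefficient, h, Nat.factorial_succ,
    Nat.cast_mul, Nat.cast_add, Nat.cast_one, mul_inv]
  field_simp

theorem add_one_ne_neg_natCast (hc : ∀ n : ℕ, c ≠ -(n : ℂ)) (n : ℕ) : c + 1 ≠ -(n : ℂ) :=
  fun h => hc (n + 1) (by push_cast; linear_combination h)

theorem add_natCast_ne_zero (hc : ∀ n : ℕ, c ≠ -(n : ℂ)) (n : ℕ) : c + n ≠ 0 :=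
  fun h => hc n (eq_neg_of_add_eq_zero_left h)

/-- The operator multiplies the $n$-th coefficient by $n+c$, and $(c+n)/(c+1)_n=c/(c)_n$. -/
theorem ordinaryHypergeometric_contiguous_lower {z : ℂ} (hc : ∀ n : ℕ, c ≠ -(n : ℂ))
    (hz : ‖z‖ < 1) :
    z * deriv (ordinaryHypergeometric a b (c + 1)) z + c * ordinaryHypergeometric a b (c + 1) z =
      c * ordinaryHypergeometric a b c z := by
  have h := hasDiscSum_ordinaryHypergeometric (a := a) (b := b) (add_one_ne_neg_natCast hc)
  have h' := hasDiscSum_ordinaryHypergeometric (a := a) (b := b) hc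
  refine ((h.id_mul_deriv.add (h.const_mul c)).congr_coeff fun n => ?_).eq (h'.const_mul c) hz
  linear_combination -ordinaryHypergeometricCoefficient_lower_add_one (a := a) (b := b) (n := n) hc

/-- The operator `z d/dz + c`, written in the variable `w = 1 - z`, acts on the slow solution. -/
theorem ordinaryHypergeometric_contiguous_slow {w : ℂ} (he : ∀ n : ℕ, a + b - c ≠ -(n : ℂ))
    (hw : ‖w‖ < 1) :
    c * ordinaryHypergeometric a b (a + b - c) w -
        (1 - w) * deriv (ordinaryHypergeometric a b (a + b - c)) w =
      (c - a) * (c - b) / (c - a - b) * ordinaryHypergeometric a b (a + b - c + 1) w := by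
  have h := hasDiscSum_ordinaryHypergeometric (a := a) (b := b) he
  have h' := hasDiscSum_ordinaryHypergeometric (a := a) (b := b) (add_one_ne_neg_natCast he)
  have hL := ((h.const_mul c).sub (h.deriv.sub h.id_mul_deriv)).congr_coeff
    (v := fun n => (c - a) * (c - b) / (c - a - b) *
      ordinaryHypergeometricCoefficient a b (a + b - c + 1) n) fun n => ?_
  · have := hL.eq (h'.const_mul _) hw
    rw [← this]
    ring
  have h1 := ordinaryHypergeometricCoefficient_succ (a := a) (b := b) (add_natCast_ne_zero he n)
  have h2 := ordinaryHypergeometricCoefficient_lower_add_one (a := a) (b := b) (n := n) he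
  have hn := add_natCast_ne_zero he n
  have h0 : c - a - b ≠ 0 := fun h => he 0 (by push_cast; linear_combination -h)
  -- Both the raised lower parameter and the shifted index are reduced to one coefficient $u_n$,
  -- leaving a rational identity.
  have h3 : ordinaryHypergeometricCoefficient a b (a + b - c + 1) n =
      (a + b - c) * ordinaryHypergeometricCoefficient a b (a + b - c) n / (a + b - c + n) := by
    rw [h2]
    field_simp
  have h4 : ((n : ℂ) + 1) * ordinaryHypergeometricCoefficient a b (a + b - c) (n + 1) =
      (a + n) * (b + n) * ordinaryHypergeometricCoefficient a b (a + b - c) n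
        / (a + b - c + n) := by
    rw [← h1]
    field_simp
  rw [h3, h4]
  generalize ordinaryHypergeometricCoefficient a b (a + b - c) n = u
  field_simp
  ring

/-- The operator `z d/dz + c`, written in the variable `w = 1 - z`, acts on the fast solution
with the factor `w ^ s` removed. -/
theorem ordinaryHypergeometric_contiguous_fast {p q r w : ℂ} (hr : ∀ n : ℕ, r ≠ -(n : ℂ))
    (hw : ‖w‖ < 1) :
    r * ((1 - w) * ordinaryHypergeometric (p + 1) (q + 1) (r + 1) w)
        + (1 - w) * (w * deriv (ordinaryHypergeometric (p + 1) (q + 1) (r + 1)) w)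
        - (p + q - r + 1) * (w * ordinaryHypergeometric (p + 1) (q + 1) (r + 1) w) =
      r * ordinaryHypergeometric p q r w := by
  have h := hasDiscSum_ordinaryHypergeometric (a := p + 1) (b := q + 1)
    (add_one_ne_neg_natCast hr)
  have h' := hasDiscSum_ordinaryHypergeometric (a := p) (b := q) hr
  have hL := ((((h.sub h.id_mul).const_mul r).add
    (h.id_mul_deriv.sub h.id_mul_deriv.id_mul)).sub
      (h.id_mul.const_mul (p + q - r + 1))).congr_coeff
    (v := fun n => r * ordinaryHypergeometricCoefficient p q r n) fun n => ?_
  · have := hL.eq (h'.const_mul r) hw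
    rw [← this]
    ring
  cases n with
  | zero =>
    simp only [Nat.cast_zero, Nat.rec_zero, ordinaryHypergeometricCoefficient_zero]
    ring
  | succ n =>
    have h1 := ordinaryHypergeometricCoefficient_succ (a := p + 1) (b := q + 1)
      (add_natCast_ne_zero (add_one_ne_neg_natCast hr) n)
    have h2 := ordinaryHypergeometricCoefficient_add_one (a := p) (b := q) hr n
    have hn : (n : ℂ) + 1 ≠ 0 := by exact_mod_cast n.succ_ne_zero
    refine mul_left_cancel₀ hn ?_
    push_cast
    linear_combination h1 - h2

end Contiguity

/-! ### The basis at $z=1$ -/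

/-- The solution of the Gauss equation that is analytic at `z = 1` with value `1`. -/
noncomputable def gaussSlow (a b c : ℂ) (z : ℂ) : ℂ :=
  ordinaryHypergeometric a b (a + b - c + 1) (1 - z)

/-- The solution of the Gauss equation that behaves like `(1 - z) ^ (c - a - b)` at `z = 1`. -/
noncomputable def gaussFast (a b c : ℂ) (z : ℂ) : ℂ :=
  (1 - z) ^ (c - a - b) * ordinaryHypergeometric (c - a) (c - b) (c - a - b + 1) (1 - z)

section Basis

variable {a b c z : ℂ}

theorem gaussFast_eq (a b c z : ℂ) :
    gaussFast a b c z = (1 - z) ^ (c - a - b) * gaussSlow (c - a) (c - b) c z := by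
  rw [gaussFast, gaussSlow, show c - a + (c - b) - c + 1 = c - a - b + 1 by ring]

theorem one_sub_cpow_mul_gaussFast (a b c : ℂ) (hz : 1 - z ≠ 0) :
    (1 - z) ^ (a + b - c) * gaussFast a b c z = gaussSlow (c - a) (c - b) c z := by
  rw [gaussFast_eq, ← mul_assoc, ← Complex.cpow_add _ _ hz]
  ring_nf
  simp

/-- The exponent difference at `z = 1` is not an integer. -/
def Nonresonant (a b c : ℂ) : Prop := ∀ n : ℤ, c - a - b ≠ n

namespace Nonresonant

theorem swap (hs : Nonresonant a b c) : Nonresonant (c - a) (c - b) c := fun n h =>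
  hs (-n) (by push_cast; linear_combination -h)

theorem succ (hs : Nonresonant a b c) : Nonresonant a b (c + 1) := fun n h =>
  hs (n - 1) (by push_cast; linear_combination h)

theorem ne_zero (hs : Nonresonant a b c) : c - a - b ≠ 0 := by simpa using hs 0

theorem slow_ne (hs : Nonresonant a b c) (n : ℕ) : a + b - c ≠ -(n : ℂ) := fun h =>
  hs n (by push_cast; linear_combination -h)

theorem fast_ne (hs : Nonresonant a b c) (n : ℕ) : c - a - b + 1 ≠ -(n : ℂ) := fun h =>
  hs (-n - 1) (by push_cast; linear_combination h)

end Nonresonant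

theorem solvesGaussAt_gaussSlow (hs : Nonresonant a b c) (hz : ‖1 - z‖ < 1) :
    SolvesGaussAt a b c (gaussSlow a b c) z :=
  (solvesGaussAt_ordinaryHypergeometric (add_one_ne_neg_natCast hs.slow_ne) hz).comp_one_sub

theorem solvesGaussAt_gaussFast (hs : Nonresonant a b c) (hz : ‖1 - z‖ < 1)
    (hz' : 1 - z ∈ Complex.slitPlane) : SolvesGaussAt a b c (gaussFast a b c) z := by
  rw [show gaussFast a b c = fun x => (1 - x) ^ (c - a - b) * gaussSlow (c - a) (c - b) c x from
    funext (gaussFast_eq a b c)]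
  exact (solvesGaussAt_gaussSlow hs.swap hz).one_sub_cpow_mul hz'

theorem deriv_gaussSlow (a b c z : ℂ) : deriv (gaussSlow a b c) z =
    -deriv (ordinaryHypergeometric a b (a + b - c + 1)) (1 - z) :=
  deriv_comp_const_sub _ 1 z

theorem deriv_gaussFast (hs : Nonresonant a b c) (hz : ‖1 - z‖ < 1)
    (hz' : 1 - z ∈ Complex.slitPlane) : deriv (gaussFast a b c) z =
      (1 - z) ^ (c - a - b - 1) *
        (-(c - a - b) * ordinaryHypergeometric (c - a) (c - b) (c - a - b + 1) (1 - z) -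
          (1 - z) * deriv (ordinaryHypergeometric (c - a) (c - b) (c - a - b + 1)) (1 - z)) := by
  have h := (solvesGaussAt_gaussSlow hs.swap hz).1.differentiableAt
  have hw := Complex.slitPlane_ne_zero hz'
  rw [show gaussFast a b c = fun x => (1 - x) ^ (c - a - b) * gaussSlow (c - a) (c - b) c x from
    funext (gaussFast_eq a b c), deriv_one_sub_cpow_mul h hz', deriv_gaussSlow, gaussSlow,
    show c - a + (c - b) - c + 1 = c - a - b + 1 by ring, Complex.cpow_sub _ 1 hw,
    Complex.cpow_one]
  field_simp
  ring

theorem gaussSlow_contiguous (hs : Nonresonant a b c) (hz : ‖1 - z‖ < 1) :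
    z * deriv (gaussSlow a b (c + 1)) z + c * gaussSlow a b (c + 1) z =
      (c - a) * (c - b) / (c - a - b) * gaussSlow a b c z := by
  have h := ordinaryHypergeometric_contiguous_slow hs.slow_ne hz
  rw [deriv_gaussSlow, gaussSlow, gaussSlow, show a + b - (c + 1) + 1 = a + b - c by ring]
  linear_combination h

theorem gaussFast_contiguous (hs : Nonresonant a b c) (hz : ‖1 - z‖ < 1)
    (hz' : 1 - z ∈ Complex.slitPlane) :
    z * deriv (gaussFast a b (c + 1)) z + c * gaussFast a b (c + 1) z =
      -(c - a - b + 1) * gaussFast a b c z := by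
  have h := ordinaryHypergeometric_contiguous_fast (p := c - a) (q := c - b) hs.fast_ne hz
  have hw := Complex.slitPlane_ne_zero hz'
  rw [deriv_gaussFast hs.succ hz hz', gaussFast, gaussFast,
    show c + 1 - a = c - a + 1 by ring, show c + 1 - b = c - b + 1 by ring,
    show c - a + 1 - b = c - a - b + 1 by ring, add_sub_cancel_right,
    Complex.cpow_add _ _ hw, Complex.cpow_one]
  linear_combination -(1 - z) ^ (c - a - b) * h

end Basis

section UnitInterval

variable {t : ℝ}

theorem norm_ofReal_lt_one (ht : t ∈ Ioo (0 : ℝ) 1) : ‖(t : ℂ)‖ < 1 := by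
  rw [Complex.norm_real, Real.norm_eq_abs, abs_of_pos ht.1]
  exact ht.2

theorem norm_one_sub_ofReal_lt_one (ht : t ∈ Ioo (0 : ℝ) 1) : ‖1 - (t : ℂ)‖ < 1 := by
  have := norm_ofReal_lt_one (t := 1 - t) ⟨by linarith [ht.2], by linarith [ht.1]⟩
  simpa using this

theorem one_sub_mem_slitPlane {z : ℂ} (hz : ‖z‖ < 1) : 1 - z ∈ Complex.slitPlane := by
  refine Or.inl ?_
  have := (Complex.re_le_norm z).trans_lt hz
  simpa using this

theorem one_sub_ofReal_mem_slitPlane (ht : t ∈ Ioo (0 : ℝ) 1) :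
    1 - (t : ℂ) ∈ Complex.slitPlane :=
  one_sub_mem_slitPlane (norm_ofReal_lt_one ht)

theorem eventually_mem_Ioo_zero_one : ∀ᶠ t : ℝ in 𝓝[<] 1, t ∈ Ioo (0 : ℝ) 1 :=
  Ioo_mem_nhdsLT one_pos

theorem tendsto_one_sub_ofReal : Tendsto (fun t : ℝ => 1 - (t : ℂ)) (𝓝[<] 1) (𝓝 0) := by
  have : ContinuousAt (fun t : ℝ => 1 - (t : ℂ)) 1 := by fun_prop
  simpa using this.tendsto.mono_left nhdsWithin_le_nhds

end UnitInterval

/-- A complex derivative is determined by real increments, so identities known only on the real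
interval can be differentiated. -/
theorem deriv_eq_of_eventuallyEq_ofReal {f g : ℂ → ℂ} {t : ℝ} (hf : DifferentiableAt ℂ f t)
    (hg : DifferentiableAt ℂ g t) (h : (fun x : ℝ => f x) =ᶠ[𝓝 t] fun x => g x) :
    deriv f t = deriv g t :=
  hf.hasDerivAt.comp_ofReal.unique (hg.hasDerivAt.comp_ofReal.congr_of_eventuallyEq h)

/-- An equality on a left neighbourhood is an equality of germs at each nearby point. -/
theorem eventually_eventuallyEq_nhdsLT {f g : ℝ → ℂ} {x : ℝ} (h : f =ᶠ[𝓝[<] x] g) :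
    ∀ᶠ t in 𝓝[<] x, f =ᶠ[𝓝 t] g := by
  filter_upwards [eventually_eventually_nhdsWithin.2 h, self_mem_nhdsWithin] with t ht hx
  rwa [IsOpen.nhdsWithin_eq isOpen_Iio hx] at ht

/-! ### Abel's identity and Cramer's rule -/

section Wronskian

variable {a b c : ℂ} {f g : ℝ → ℂ}

theorem IsHypergeometricSolution.hasDerivAt_wronskian (hf : IsHypergeometricSolution a b c f)
    (hg : IsHypergeometricSolution a b c g) {t : ℝ} (ht : t ∈ Ioo (0 : ℝ) 1) :
    HasDerivAt (fun x => f x * deriv g x - deriv f x * g x)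
      (-(c - (a + b + 1) * t) / (t * (1 - t)) * (f t * deriv g t - deriv f t * g t)) t := by
  obtain ⟨hf1, hf2, hf3⟩ := hf t ht
  obtain ⟨hg1, hg2, hg3⟩ := hg t ht
  have h := (hf1.hasDerivAt.mul hg2.hasDerivAt).sub (hf2.hasDerivAt.mul hg1.hasDerivAt)
  have h0 : (t : ℂ) ≠ 0 := by exact_mod_cast ht.1.ne'
  have h1 : 1 - (t : ℂ) ≠ 0 := Complex.slitPlane_ne_zero (one_sub_ofReal_mem_slitPlane ht)
  refine h.congr_deriv ?_
  field_simp
  linear_combination f t * hg3 - g t * hf3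

/-- Cramer's rule: $f\,W(y_1,y_2)=y_1W(f,y_2)+y_2W(y_1,f)$, and the quotients of these Wronskians
are constant by Abel's identity. -/
theorem IsHypergeometricSolution.exists_eq_linear_combination {y₁ y₂ : ℝ → ℂ} {δ : ℝ}
    (hδ : 0 ≤ δ)
    (hf : IsHypergeometricSolution a b c f) (h₁ : IsHypergeometricSolution a b c y₁)
    (h₂ : IsHypergeometricSolution a b c y₂)
    (hW : ∀ t ∈ Ioo δ 1, y₁ t * deriv y₂ t - deriv y₁ t * y₂ t ≠ 0) :
    ∃ k : ℂ × ℂ, ∀ t ∈ Ioo δ 1, f t = k.1 * y₁ t + k.2 * y₂ t := by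
  have hsub : ∀ t ∈ Ioo δ 1, t ∈ Ioo (0 : ℝ) 1 := fun t ht => ⟨hδ.trans_lt ht.1, ht.2⟩
  have key : ∀ u v : ℝ → ℂ, IsHypergeometricSolution a b c u → IsHypergeometricSolution a b c v →
      ∃ k : ℂ, ∀ t ∈ Ioo δ 1, u t * deriv v t - deriv u t * v t =
        k * (y₁ t * deriv y₂ t - deriv y₁ t * y₂ t) := by
    intro u v hu hv
    have hd : ∀ t ∈ Ioo δ 1, HasDerivAt (fun x => (u x * deriv v x - deriv u x * v x) /
        (y₁ x * deriv y₂ x - deriv y₁ x * y₂ x)) 0 t := fun t ht => by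
      refine ((hu.hasDerivAt_wronskian hv (hsub t ht)).div
        (h₁.hasDerivAt_wronskian h₂ (hsub t ht)) (hW t ht)).congr_deriv ?_
      ring
    obtain ⟨k, hk⟩ := isOpen_Ioo.exists_is_const_of_deriv_eq_zero
      (isPreconnected_Ioo (a := δ) (b := 1))
      (fun t ht => (hd t ht).differentiableAt.differentiableWithinAt)
      (fun t ht => (hd t ht).deriv)
    exact ⟨k, fun t ht => by rw [← hk t ht, div_mul_cancel₀ _ (hW t ht)]⟩
  obtain ⟨k₁, hk₁⟩ := key f y₂ hf h₂
  obtain ⟨k₂, hk₂⟩ := key y₁ f h₁ hf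
  refine ⟨(k₁, k₂), fun t ht => mul_left_cancel₀ (hW t ht) ?_⟩
  linear_combination y₁ t * hk₁ t ht + y₂ t * hk₂ t ht

end Wronskian

/-! ### Existence and uniqueness of the expansion -/

/-- `f = k.1 * gaussSlow + k.2 * gaussFast` near the endpoint `1`. -/
def HasGaussExpansion (a b c : ℂ) (f : ℝ → ℂ) (k : ℂ × ℂ) : Prop :=
  ∀ᶠ t : ℝ in 𝓝[<] 1, f t = k.1 * gaussSlow a b c t + k.2 * gaussFast a b c t

section Expansion

variable {a b c : ℂ} {f : ℝ → ℂ}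

/-- With $w=1-z$, the Wronskian is $w^{c-a-b-1}$ times a function continuous at $w=0$ with value
$-(c-a-b)\ne0$. -/
theorem eventually_wronskian_ne_zero (hs : Nonresonant a b c) :
    ∀ᶠ t : ℝ in 𝓝[<] 1, gaussSlow a b c t * deriv (gaussFast a b c) t -
      deriv (gaussSlow a b c) t * gaussFast a b c t ≠ 0 := by
  set G₁ := ordinaryHypergeometric (𝔸 := ℂ) a b (a + b - c + 1) with hG₁
  set G₂ := ordinaryHypergeometric (𝔸 := ℂ) (c - a) (c - b) (c - a - b + 1) with hG₂
  have hA₁ : AnalyticAt ℂ G₁ 0 := (hasDiscSum_ordinaryHypergeometric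
    (add_one_ne_neg_natCast hs.slow_ne)).analyticAt (by simp)
  have hA₂ : AnalyticAt ℂ G₂ 0 := (hasDiscSum_ordinaryHypergeometric hs.fast_ne).analyticAt
    (by simp)
  have hcont : ContinuousAt (fun w => G₁ w * (-(c - a - b) * G₂ w - w * deriv G₂ w)
      + w * deriv G₁ w * G₂ w) 0 := by
    have := hA₁.continuousAt
    have := hA₂.continuousAt
    have := hA₁.deriv.continuousAt
    have := hA₂.deriv.continuousAt
    fun_prop
  have hne := hcont.eventually_ne (y := 0) (by
    simp only [hG₁, hG₂, ordinaryHypergeometric_zero]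
    simpa using neg_ne_zero.2 hs.ne_zero)
  filter_upwards [tendsto_one_sub_ofReal.eventually hne, eventually_mem_Ioo_zero_one] with t h ht
  have hsl := one_sub_ofReal_mem_slitPlane ht
  have hw := Complex.slitPlane_ne_zero hsl
  rw [deriv_gaussFast hs (norm_one_sub_ofReal_lt_one ht) hsl, deriv_gaussSlow, gaussSlow,
    gaussFast]
  have hp : (1 - (t : ℂ)) ^ (c - a - b) = (1 - (t : ℂ)) ^ (c - a - b - 1) * (1 - t) := by
    rw [Complex.cpow_sub _ 1 hw, Complex.cpow_one, div_mul_cancel₀ _ hw]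
  rw [hp]
  have hpn : (1 - (t : ℂ)) ^ (c - a - b - 1) ≠ 0 := by simp [Complex.cpow_eq_zero_iff, hw]
  refine fun h0 => mul_ne_zero hpn h ?_
  linear_combination h0

theorem isHypergeometricSolution_gaussSlow (hs : Nonresonant a b c) :
    IsHypergeometricSolution a b c fun t => gaussSlow a b c t :=
  SolvesGaussAt.isHypergeometricSolution fun _ ht =>
    solvesGaussAt_gaussSlow hs (norm_one_sub_ofReal_lt_one ht)

theorem isHypergeometricSolution_gaussFast (hs : Nonresonant a b c) :
    IsHypergeometricSolution a b c fun t => gaussFast a b c t :=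
  SolvesGaussAt.isHypergeometricSolution fun _ ht =>
    solvesGaussAt_gaussFast hs (norm_one_sub_ofReal_lt_one ht) (one_sub_ofReal_mem_slitPlane ht)

theorem hasDerivAt_gaussSlow_ofReal (hs : Nonresonant a b c) {t : ℝ} (ht : t ∈ Ioo (0 : ℝ) 1) :
    HasDerivAt (fun t : ℝ => gaussSlow a b c t) (deriv (gaussSlow a b c) t) t :=
  (solvesGaussAt_gaussSlow hs
    (norm_one_sub_ofReal_lt_one ht)).1.differentiableAt.hasDerivAt.comp_ofReal

theorem hasDerivAt_gaussFast_ofReal (hs : Nonresonant a b c) {t : ℝ} (ht : t ∈ Ioo (0 : ℝ) 1) :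
    HasDerivAt (fun t : ℝ => gaussFast a b c t) (deriv (gaussFast a b c) t) t :=
  (solvesGaussAt_gaussFast hs (norm_one_sub_ofReal_lt_one ht)
    (one_sub_ofReal_mem_slitPlane ht)).1.differentiableAt.hasDerivAt.comp_ofReal

theorem IsHypergeometricSolution.exists_hasGaussExpansion (hs : Nonresonant a b c)
    (hf : IsHypergeometricSolution a b c f) : ∃ k, HasGaussExpansion a b c f k := by
  have h := (eventually_wronskian_ne_zero hs).and eventually_mem_Ioo_zero_one
  obtain ⟨δ, hδ, hδs⟩ := (mem_nhdsLT_iff_exists_mem_Ico_Ioo_subset (zero_lt_one' ℝ)).1 h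
  obtain ⟨k, hk⟩ := hf.exists_eq_linear_combination hδ.1 (isHypergeometricSolution_gaussSlow hs)
    (isHypergeometricSolution_gaussFast hs) (δ := δ) fun t ht => by
      rw [(hasDerivAt_gaussSlow_ofReal hs (hδs ht).2).deriv,
        (hasDerivAt_gaussFast_ofReal hs (hδs ht).2).deriv]
      exact (hδs ht).1
  exact ⟨k, eventually_of_mem (Ioo_mem_nhdsLT hδ.2) hk⟩

theorem HasGaussExpansion.unique (hs : Nonresonant a b c) {k l : ℂ × ℂ}
    (hk : HasGaussExpansion a b c f k) (hl : HasGaussExpansion a b c f l) : k = l := by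
  have h0 : (fun t : ℝ => (k.1 - l.1) * gaussSlow a b c t + (k.2 - l.2) * gaussFast a b c t)
      =ᶠ[𝓝[<] 1] fun _ => 0 := by
    filter_upwards [hk, hl] with t h h'
    linear_combination h' - h
  obtain ⟨t, ⟨hW, ht⟩, h⟩ := (((eventually_wronskian_ne_zero hs).and
    eventually_mem_Ioo_zero_one).and (eventually_eventuallyEq_nhdsLT h0)).exists
  have h1 := h.self_of_nhds
  have h2 := (((hasDerivAt_gaussSlow_ofReal hs ht).const_mul (k.1 - l.1)).add
    ((hasDerivAt_gaussFast_ofReal hs ht).const_mul (k.2 - l.2))).unique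
      ((hasDerivAt_const t (0 : ℂ)).congr_of_eventuallyEq h)
  simp only at h1
  refine Prod.ext (sub_eq_zero.1 (mul_left_cancel₀ hW ?_))
    (sub_eq_zero.1 (mul_left_cancel₀ hW ?_))
  · linear_combination deriv (gaussFast a b c) t * h1 - gaussFast a b c t * h2
  · linear_combination gaussSlow a b c t * h2 - deriv (gaussSlow a b c) t * h1

end Expansion

/-! ### The limit of large $c$ -/

section LargeParameter

variable {a b : ℂ}

/-- The factor $1/((n+1)(n+2))$ makes the bound summable uniformly in $c$. Its value $1/2$ at $n=0$
accounts for the constant $2$; the size of $\operatorname{Re}c$ makes the bound propagate through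
the coefficient recursion. -/
theorem norm_ordinaryHypergeometricCoefficient_le {c : ℂ}
    (hc : 3 * (‖a‖ + 1) * (‖b‖ + 1) ≤ c.re) (n : ℕ) :
    ‖ordinaryHypergeometricCoefficient a b c (n + 1)‖ ≤
      2 * ‖a‖ * ‖b‖ / c.re * (1 / ((n + 1) * (n + 2))) := by
  have ha := norm_nonneg a
  have hb := norm_nonneg b
  have hab := mul_nonneg ha hb
  have hr : 0 < c.re := lt_of_lt_of_le (by positivity) hc
  have hcn : ∀ m : ℕ, c.re + m ≤ ‖c + m‖ := fun m => by
    simpa using Complex.re_le_norm (c + m)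
  have hpos : ∀ m : ℕ, 0 < ‖c + m‖ := fun m => lt_of_lt_of_le (by positivity) (hcn m)
  have hrec : ∀ m : ℕ, ‖ordinaryHypergeometricCoefficient a b c (m + 1)‖ =
      ‖a + m‖ * ‖b + m‖ * ‖ordinaryHypergeometricCoefficient a b c m‖ /
        ((m + 1) * ‖c + m‖) := fun m => by
    have h := congrArg norm (ordinaryHypergeometricCoefficient_succ (a := a) (b := b) (c := c)
      (n := m) (norm_pos_iff.1 (hpos m)))
    have hm : ‖(m : ℂ) + 1‖ = m + 1 := by
      exact_mod_cast Complex.norm_natCast (m + 1)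
    rw [norm_mul (((m : ℂ) + 1) * (c + m)), norm_mul ((m : ℂ) + 1), norm_mul ((a + m) * (b + m)),
      norm_mul (a + m), hm] at h
    have := hpos m
    rw [eq_div_iff (by positivity), ← h]
    ring
  induction n with
  | zero =>
    rw [hrec 0, ordinaryHypergeometricCoefficient_zero]
    have := hcn 0
    simp only [Nat.cast_zero, add_zero, norm_one, mul_one, zero_add, one_mul] at this ⊢
    calc ‖a‖ * ‖b‖ / ‖c‖ ≤ ‖a‖ * ‖b‖ / c.re := by gcongr
      _ = _ := by ring
  | succ n ih =>
    rw [hrec (n + 1)]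
    have hA : ‖a + (n + 1 : ℕ)‖ ≤ ‖a‖ + (n + 1) := by
      refine (norm_add_le _ _).trans_eq ?_
      rw [Complex.norm_natCast, Nat.cast_add, Nat.cast_one]
    have hB : ‖b + (n + 1 : ℕ)‖ ≤ ‖b‖ + (n + 1) := by
      refine (norm_add_le _ _).trans_eq ?_
      rw [Complex.norm_natCast, Nat.cast_add, Nat.cast_one]
    have hC := hcn (n + 1)
    push_cast at hA hB hC ⊢
    set K := 2 * ‖a‖ * ‖b‖ / c.re with hK
    have hK0 : 0 ≤ K := by positivity
    have hn : (0 : ℝ) ≤ n := n.cast_nonneg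
    calc _ ≤ (‖a‖ + (n + 1)) * (‖b‖ + (n + 1)) * (K * (1 / ((n + 1) * (n + 2)))) /
        ((n + 1 + 1) * (c.re + (n + 1))) := by gcongr
      _ = K * ((‖a‖ + (n + 1)) * (‖b‖ + (n + 1)) /
          ((n + 1) * (n + 2) * ((n + 2) * (c.re + (n + 1))))) := by
        field_simp
        ring
      _ ≤ K * (1 / ((n + 1 + 1) * (n + 1 + 2))) := by
        refine mul_le_mul_of_nonneg_left ?_ hK0
        rw [div_le_div_iff₀ (by positivity) (by positivity)]
        have h1 : (‖a‖ + (n + 1)) * (‖b‖ + (n + 1)) * (n + 3) ≤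
            (n + 1) * (n + 2) * (c.re + (n + 1)) := by
          nlinarith [mul_le_mul_of_nonneg_left hc (by positivity : (0 : ℝ) ≤ (n + 1) * (n + 2)),
            mul_nonneg ha hn, mul_nonneg hb hn, mul_nonneg hab hn, mul_nonneg ha (mul_nonneg hn hn),
            mul_nonneg hb (mul_nonneg hn hn), mul_nonneg hab (mul_nonneg hn hn), mul_nonneg hn hn]
        nlinarith [mul_le_mul_of_nonneg_left h1 (by positivity : (0 : ℝ) ≤ n + 2)]

theorem ne_neg_natCast_of_re_pos {c : ℂ} (hc : 0 < c.re) (n : ℕ) : c ≠ -(n : ℂ) := by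
  rintro rfl
  simp only [Complex.neg_re, Complex.natCast_re] at hc
  linarith [(n.cast_nonneg : (0 : ℝ) ≤ n)]

theorem exists_norm_ordinaryHypergeometric_sub_one_le (a b : ℂ) :
    ∃ C R : ℝ, 0 < R ∧ ∀ c : ℂ, R ≤ c.re → ∀ z : ℂ, ‖z‖ < 1 →
      ‖ordinaryHypergeometric a b c z - 1‖ ≤ C / c.re := by
  have hS : Summable fun n : ℕ => 1 / (((n : ℝ) + 1) * (n + 2)) := by
    refine Summable.of_nonneg_of_le (fun n => by positivity) (fun n => ?_)
      ((summable_nat_add_iff 1).2 (Real.summable_one_div_nat_pow.2 one_lt_two))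
    push_cast
    gcongr
    nlinarith [(n.cast_nonneg : (0 : ℝ) ≤ n)]
  refine ⟨2 * ‖a‖ * ‖b‖ * ∑' n : ℕ, 1 / (((n : ℝ) + 1) * (n + 2)),
    3 * (‖a‖ + 1) * (‖b‖ + 1), by positivity, fun c hc z hz => ?_⟩
  have hr : 0 < c.re := lt_of_lt_of_le (by positivity) hc
  have h := (hasSum_nat_add_iff' 1).2
    (hasDiscSum_ordinaryHypergeometric (a := a) (b := b) (ne_neg_natCast_of_re_pos hr) z hz)
  simp only [Finset.range_one, Finset.sum_singleton, ordinaryHypergeometricCoefficient_zero,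
    pow_zero, mul_one] at h
  rw [← h.tsum_eq]
  refine (tsum_of_norm_bounded (hS.hasSum.mul_left (2 * ‖a‖ * ‖b‖ / c.re)) fun n => ?_).trans_eq
    (by ring)
  rw [norm_mul, norm_pow]
  exact (mul_le_of_le_one_right (norm_nonneg _) (pow_le_one₀ (norm_nonneg _) hz.le)).trans
    (norm_ordinaryHypergeometricCoefficient_le hc n)

end LargeParameter

/-- At $s=-m$ a factor of the product in `GammaSeq` vanishes once $n\ge m$, and division by zero
gives $0$, matching the value of `Complex.Gamma` at a pole. Hence $c-a$ and $c-b$ may be poles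
later. -/
theorem tendsto_inv_GammaSeq (s : ℂ) :
    Tendsto (fun n => (Complex.GammaSeq s n)⁻¹) atTop (𝓝 (Complex.Gamma s)⁻¹) := by
  by_cases h : Complex.Gamma s = 0
  · obtain ⟨m, rfl⟩ := (Complex.Gamma_eq_zero_iff s).1 h
    rw [h]
    refine tendsto_const_nhds.congr' ?_
    filter_upwards [eventually_ge_atTop m] with n hn
    rw [Complex.GammaSeq, Finset.prod_eq_zero (Finset.mem_range.2 (Nat.lt_succ_of_le hn))
      (neg_add_cancel _)]
    simp
  · exact (Complex.GammaSeq_tendsto_Gamma s).inv₀ h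

/-! ### The limit at $z=1$ and the step from $c+1$ to $c$ -/

section Slow

variable {a b c : ℂ}

theorem isHypergeometricSolution_ordinaryHypergeometric (hc : ∀ n : ℕ, c ≠ -(n : ℂ)) :
    IsHypergeometricSolution a b c fun t => ordinaryHypergeometric a b c (t : ℂ) :=
  SolvesGaussAt.isHypergeometricSolution fun _ ht =>
    solvesGaussAt_ordinaryHypergeometric hc (norm_ofReal_lt_one ht)

/-- Both hypergeometric factors tend to $1$, and the fast power tends to $0$ when its exponent has
positive real part. -/
theorem HasGaussExpansion.tendsto (hs : Nonresonant a b c) (hre : 0 < (c - a - b).re) {f : ℝ → ℂ}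
    {k : ℂ × ℂ} (h : HasGaussExpansion a b c f k) : Tendsto f (𝓝[<] 1) (𝓝 k.1) := by
  have hG : ∀ {p q r : ℂ}, (∀ n : ℕ, r ≠ -(n : ℂ)) →
      Tendsto (fun t : ℝ => ordinaryHypergeometric p q r (1 - (t : ℂ))) (𝓝[<] 1) (𝓝 1) := by
    intro p q r hr
    have := ((hasDiscSum_ordinaryHypergeometric (a := p) (b := q) hr).analyticAt
      (z := 0) (by simp)).continuousAt.tendsto
    rw [ordinaryHypergeometric_zero] at this
    exact this.comp tendsto_one_sub_ofReal
  have hp : Tendsto (fun t : ℝ => (1 - (t : ℂ)) ^ (c - a - b)) (𝓝[<] 1) (𝓝 0) := by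
    have := (Complex.continuousAt_cpow_const_of_re_pos (z := 0) (w := c - a - b)
      (Or.inl le_rfl) hre).tendsto
    rw [Complex.zero_cpow hs.ne_zero] at this
    exact this.comp tendsto_one_sub_ofReal
  have := ((hG (p := a) (q := b) (add_one_ne_neg_natCast hs.slow_ne)).const_mul k.1).add
    ((hp.mul (hG (p := c - a) (q := c - b) hs.fast_ne)).const_mul k.2)
  simp only [mul_one, mul_zero, add_zero] at this
  exact this.congr' (EventuallyEq.symm h)

theorem HasGaussExpansion.contiguous (hc : ∀ n : ℕ, c ≠ -(n : ℂ)) (hs : Nonresonant a b c)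
    {k : ℂ × ℂ}
    (h : HasGaussExpansion a b (c + 1) (fun t => ordinaryHypergeometric a b (c + 1) (t : ℂ)) k) :
    HasGaussExpansion a b c (fun t => ordinaryHypergeometric a b c (t : ℂ))
      (k.1 * ((c - a) * (c - b) / (c - a - b)) / c, k.2 * -(c - a - b + 1) / c) := by
  have hc0 : c ≠ 0 := by simpa using hc 0
  filter_upwards [eventually_eventuallyEq_nhdsLT h, eventually_mem_Ioo_zero_one] with t he ht
  have hz := norm_ofReal_lt_one ht
  have hw := norm_one_sub_ofReal_lt_one ht
  have hsl := one_sub_ofReal_mem_slitPlane ht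
  have d₀ := (solvesGaussAt_ordinaryHypergeometric (a := a) (b := b)
    (add_one_ne_neg_natCast hc) hz).1.differentiableAt
  have d₁ := (solvesGaussAt_gaussSlow hs.succ hw).1.differentiableAt
  have d₂ := (solvesGaussAt_gaussFast hs.succ hw hsl).1.differentiableAt
  have hd := deriv_eq_of_eventuallyEq_ofReal d₀ ((d₁.const_mul k.1).add (d₂.const_mul k.2)) he
  rw [((d₁.hasDerivAt.const_mul k.1).add (d₂.hasDerivAt.const_mul k.2)).deriv] at hd
  have he' := he.self_of_nhds
  have h₀ := ordinaryHypergeometric_contiguous_lower (a := a) (b := b) hc hz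
  have h₁ := gaussSlow_contiguous hs hw
  have h₂ := gaussFast_contiguous hs hw hsl
  simp only at he' ⊢
  refine mul_left_cancel₀ hc0 ?_
  rw [← h₀, hd, he']
  field_simp
  linear_combination k.1 * h₁ + k.2 * h₂

end Slow

/-! ### The slow connection coefficient -/

section ConnectionCoefficients

variable {a b c : ℂ} {k : ℂ × ℂ}

theorem HasGaussExpansion.fst_eq_Gamma (hc : ∀ n : ℕ, c ≠ -(n : ℂ)) (hs : Nonresonant a b c)
    (h : HasGaussExpansion a b c (fun t => ordinaryHypergeometric a b c (t : ℂ)) k) :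
    k.1 = Complex.Gamma c * Complex.Gamma (c - a - b) /
      (Complex.Gamma (c - a) * Complex.Gamma (c - b)) := by
  have hcn : ∀ N n : ℕ, c + N ≠ -(n : ℂ) := fun N n h =>
    hc (N + n) (by push_cast; linear_combination h)
  have hsn : ∀ N : ℕ, Nonresonant a b (c + N) := fun N n h =>
    hs (n - N) (by push_cast; linear_combination h)
  choose K hK using fun N : ℕ => (isHypergeometricSolution_ordinaryHypergeometric
    (a := a) (b := b) (hcn N)).exists_hasGaussExpansion (hsn N)
  have hK0 : K 0 = k := HasGaussExpansion.unique hs (by simpa using hK 0) h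
  have hrec : ∀ N : ℕ, (K N).1 * ((c + N) * (c - a - b + N)) =
      (K (N + 1)).1 * ((c - a + N) * (c - b + N)) := fun N => by
    have h1 := hK (N + 1)
    rw [show c + ((N + 1 : ℕ) : ℂ) = c + N + 1 by push_cast; ring] at h1
    rw [(hK N).unique (hsn N) (h1.contiguous (hcn N) (hsn N))]
    have e1 := add_natCast_ne_zero hc N
    have e2 : c + N - a - b ≠ 0 := (hsn N).ne_zero
    rw [show c - a - b + (N : ℂ) = c + N - a - b by ring]
    simp only
    field_simp
    ring
  have hprod : ∀ N : ℕ, (K 0).1 * ((∏ j ∈ Finset.range N, (c + j)) *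
      ∏ j ∈ Finset.range N, (c - a - b + j)) = (K N).1 * ((∏ j ∈ Finset.range N, (c - a + j)) *
      ∏ j ∈ Finset.range N, (c - b + j)) := fun N => by
    induction N with
    | zero => simp
    | succ N ih =>
      simp only [Finset.prod_range_succ]
      linear_combination ((c + N) * (c - a - b + N)) * ih +
        ((∏ j ∈ Finset.range N, (c - a + j)) * ∏ j ∈ Finset.range N, (c - b + j)) * hrec N
  -- `GammaSeq s n` has $n+1$ factors in its denominator, hence the index $n+1$ of $K$. The
  -- factorials cancel, and so do the powers of $n$, because $c+(c-a-b)=(c-a)+(c-b)$.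
  have hseq : ∀ᶠ n : ℕ in atTop, k.1 = (K (n + 1)).1 *
      (Complex.GammaSeq c n * Complex.GammaSeq (c - a - b) n *
        ((Complex.GammaSeq (c - a) n)⁻¹ * (Complex.GammaSeq (c - b) n)⁻¹)) := by
    filter_upwards [eventually_ne_atTop 0] with n hn
    have hn' : (n : ℂ) ≠ 0 := by exact_mod_cast hn
    have hf : (n.factorial : ℂ) ≠ 0 := by exact_mod_cast n.factorial_ne_zero
    have hpow : ∀ x : ℂ, (n : ℂ) ^ x ≠ 0 := fun x => by simp [Complex.cpow_eq_zero_iff, hn']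
    have h1 : ∏ j ∈ Finset.range (n + 1), (c + j) ≠ 0 :=
      Finset.prod_ne_zero_iff.2 fun j _ => add_natCast_ne_zero hc j
    have h2 : ∏ j ∈ Finset.range (n + 1), (c - a - b + j) ≠ 0 :=
      Finset.prod_ne_zero_iff.2 fun j _ h => hs (-j) (by push_cast; linear_combination h)
    have h3 : (n : ℂ) ^ c * (n : ℂ) ^ (c - a - b) = (n : ℂ) ^ (c - a) * (n : ℂ) ^ (c - b) := by
      rw [← Complex.cpow_add _ _ hn', ← Complex.cpow_add _ _ hn']
      ring_nf
    have h4 := hprod (n + 1)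
    have e1 := hpow (c - a)
    have e2 := hpow (c - b)
    rw [← hK0, Complex.GammaSeq, Complex.GammaSeq, Complex.GammaSeq, Complex.GammaSeq, inv_div,
      inv_div, eq_comm]
    calc _ = (K (n + 1)).1 * ((∏ j ∈ Finset.range (n + 1), (c - a + j)) *
          ∏ j ∈ Finset.range (n + 1), (c - b + j)) * ((n : ℂ) ^ c * (n : ℂ) ^ (c - a - b)) /
          ((∏ j ∈ Finset.range (n + 1), (c + j)) *
            (∏ j ∈ Finset.range (n + 1), (c - a - b + j)) *
              ((n : ℂ) ^ (c - a) * (n : ℂ) ^ (c - b))) := by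
          field_simp
      _ = _ := by
          rw [← h4, h3]
          field_simp
  obtain ⟨C, R, hR, hbound⟩ := exists_norm_ordinaryHypergeometric_sub_one_le a b
  have hre : Tendsto (fun n : ℕ => (c + ((n + 1 : ℕ) : ℂ)).re) atTop atTop := by
    simp only [Complex.add_re, Complex.natCast_re]
    exact tendsto_atTop_add_const_left _ _
      (tendsto_natCast_atTop_atTop.comp (tendsto_add_atTop_nat 1))
  -- The bound $C/\operatorname{Re}(c+n+1)$ is uniform in $z$, so it survives the limit $z\to1$ that
  -- identifies the slow coefficient.
  have hlim : Tendsto (fun n : ℕ => (K (n + 1)).1) atTop (𝓝 1) := by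
    rw [tendsto_iff_norm_sub_tendsto_zero]
    refine squeeze_zero' (Eventually.of_forall fun n => norm_nonneg _) ?_
      (hre.const_div_atTop C)
    filter_upwards [hre.eventually_ge_atTop R, hre.eventually_gt_atTop (a + b).re] with n h1 h2
    have ht := (hK (n + 1)).tendsto (hsn (n + 1)) (by
      simp only [Complex.sub_re, Complex.add_re] at h2 ⊢
      linarith)
    refine le_of_tendsto (ht.sub_const 1).norm ?_
    filter_upwards [eventually_mem_Ioo_zero_one] with t ht
    exact hbound _ h1 _ (norm_ofReal_lt_one ht)
  have hfin := hlim.mul (((Complex.GammaSeq_tendsto_Gamma c).mul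
    (Complex.GammaSeq_tendsto_Gamma (c - a - b))).mul
      ((tendsto_inv_GammaSeq (c - a)).mul (tendsto_inv_GammaSeq (c - b))))
  rw [tendsto_nhds_unique (tendsto_const_nhds.congr' hseq) hfin, one_mul, ← mul_inv,
    div_eq_mul_inv]

end ConnectionCoefficients

/-! ### Euler's transformation and the fast coefficient -/

section EulerTransformation

variable {a b c : ℂ}

theorem SolvesGaussAt.sub {f g : ℂ → ℂ} {z : ℂ} (hf : SolvesGaussAt a b c f z)
    (hg : SolvesGaussAt a b c g z) : SolvesGaussAt a b c (fun x => f x - g x) z := by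
  refine ⟨hf.1.sub hg.1, ?_⟩
  have h : deriv (fun x => f x - g x) =ᶠ[𝓝 z] fun x => deriv f x - deriv g x := by
    filter_upwards [hf.1.eventually_analyticAt, hg.1.eventually_analyticAt] with x h1 h2
    exact deriv_fun_sub h1.differentiableAt h2.differentiableAt
  rw [h.deriv_eq, h.self_of_nhds, deriv_fun_sub hf.1.deriv.differentiableAt
    hg.1.deriv.differentiableAt]
  linear_combination hf.2 - hg.2

/-- A solution of the Gauss equation that is analytic at `0` and vanishes there is zero. -/
theorem eventually_eq_zero_of_solvesGaussAt (hc : ∀ n : ℕ, c ≠ -(n : ℂ)) {f : ℂ → ℂ}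
    (hf : ∀ᶠ z in 𝓝 0, SolvesGaussAt a b c f z) (h0 : f 0 = 0) : ∀ᶠ z in 𝓝 0, f z = 0 := by
  by_contra hne
  -- Frobenius argument: write $f=z^{m+1}g$ with $g(0)\ne0$ and compare leading terms.
  obtain ⟨n, g, hg, hg0, hfg⟩ :=
    hf.self_of_nhds.1.exists_eventuallyEq_pow_smul_nonzero_iff.2 hne
  simp only [sub_zero, smul_eq_mul] at hfg
  obtain _ | m := n
  · exact hg0 (by simpa [h0] using hfg.self_of_nhds.symm)
  set g₁ : ℂ → ℂ := fun z => (m + 1) * g z + z * deriv g z with hg₁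
  have hg₁a : AnalyticAt ℂ g₁ 0 := by
    have := hg.deriv
    fun_prop
  have hd : ∀ᶠ z in 𝓝 0, deriv f z = z ^ m * g₁ z := by
    filter_upwards [eventually_eventually_nhds.2 hfg, hg.eventually_analyticAt] with z hz hgz
    rw [EventuallyEq.deriv_eq hz, ((hasDerivAt_pow (m + 1) z).fun_mul
      hgz.differentiableAt.hasDerivAt).deriv, hg₁]
    push_cast
    ring
  have hd2 : ∀ᶠ z in 𝓝 0, z * deriv (deriv f) z = z ^ m * (m * g₁ z + z * deriv g₁ z) := by
    filter_upwards [eventually_eventually_nhds.2 hd, hg₁a.eventually_analyticAt] with z hz hgz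
    rw [EventuallyEq.deriv_eq hz, ((hasDerivAt_pow m z).fun_mul
      hgz.differentiableAt.hasDerivAt).deriv]
    cases m with
    | zero => simp
    | succ m =>
      simp only [add_tsub_cancel_right]
      ring
  -- The Gauss operator applied to $f$, divided by $z^m$; its value at $0$ is the indicial
  -- expression $(c+m)(m+1)g(0)$, nonzero by the condition on $c$.
  set H : ℂ → ℂ := fun z => (1 - z) * (m * g₁ z + z * deriv g₁ z) +
    (c - (a + b + 1) * z) * g₁ z - a * b * z * g z with hH
  have hHc : ContinuousAt H 0 := by
    have := hg₁a.continuousAt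
    have := hg₁a.deriv.continuousAt
    have := hg.continuousAt
    fun_prop
  have hH0 : ∀ᶠ z in 𝓝[≠] 0, H z = 0 := by
    filter_upwards [hf.filter_mono nhdsWithin_le_nhds, hfg.filter_mono nhdsWithin_le_nhds,
      hd.filter_mono nhdsWithin_le_nhds, hd2.filter_mono nhdsWithin_le_nhds,
      self_mem_nhdsWithin] with z h1 h2 h3 h4 hz
    refine (mul_eq_zero.1 ?_).resolve_left (pow_ne_zero m hz)
    have h5 := h1.2
    rw [h2, h3] at h5
    rw [hH]
    linear_combination h5 - (1 - z) * h4
  have hval : H 0 = 0 := tendsto_nhds_unique (hHc.tendsto.mono_left nhdsWithin_le_nhds)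
    (tendsto_const_nhds.congr' (EventuallyEq.symm hH0))
  have hval' : (c + m) * ((m + 1) * g 0) = 0 := by
    simp only [hH, hg₁] at hval
    linear_combination hval
  have hm : (m : ℂ) + 1 ≠ 0 := by exact_mod_cast m.succ_ne_zero
  exact mul_ne_zero (add_natCast_ne_zero hc m) (mul_ne_zero hm hg0) hval'

/-- **Euler's transformation** of the hypergeometric function. -/
theorem ordinaryHypergeometric_eq_one_sub_cpow_mul {z : ℂ} (hc : ∀ n : ℕ, c ≠ -(n : ℂ))
    (hz : ‖z‖ < 1) : ordinaryHypergeometric a b c z =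
      (1 - z) ^ (c - a - b) * ordinaryHypergeometric (c - a) (c - b) c z := by
  have hsol : ∀ z : ℂ, ‖z‖ < 1 → SolvesGaussAt a b c (fun z => ordinaryHypergeometric a b c z -
      (1 - z) ^ (c - a - b) * ordinaryHypergeometric (c - a) (c - b) c z) z := fun z hz =>
    (solvesGaussAt_ordinaryHypergeometric hc hz).sub
      ((solvesGaussAt_ordinaryHypergeometric hc hz).one_sub_cpow_mul (one_sub_mem_slitPlane hz))
  have hball : ∀ᶠ z : ℂ in 𝓝 0, ‖z‖ < 1 := by
    filter_upwards [Metric.ball_mem_nhds (0 : ℂ) one_pos] with z hz using by simpa using hz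
  -- Both sides equal $1$ at the origin, so their difference vanishes near $0$; the identity theorem
  -- extends this to the disc.
  have h0 := eventually_eq_zero_of_solvesGaussAt hc (hball.mono hsol) (by simp)
  have han : AnalyticOnNhd ℂ (fun z : ℂ => ordinaryHypergeometric a b c z -
      (1 - z) ^ (c - a - b) * ordinaryHypergeometric (c - a) (c - b) c z) (Metric.ball (0 : ℂ) 1) :=
    fun z hz => (hsol z (by simpa using hz)).1
  exact sub_eq_zero.1 (han.eqOn_zero_of_preconnected_of_eventuallyEq_zero
    (convex_ball _ _).isPreconnected (Metric.mem_ball_self one_pos) h0 (by simpa using hz))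

/-- Multiplication by $(1-z)^{a+b-c}$ carries the slow and fast solutions for $(a,b)$ to the fast
and slow ones for $(c-a,c-b)$. -/
theorem HasGaussExpansion.swap {k : ℂ × ℂ} (hc : ∀ n : ℕ, c ≠ -(n : ℂ))
    (h : HasGaussExpansion a b c (fun t => ordinaryHypergeometric a b c (t : ℂ)) k) :
    HasGaussExpansion (c - a) (c - b) c
      (fun t => ordinaryHypergeometric (c - a) (c - b) c (t : ℂ)) k.swap := by
  filter_upwards [h, eventually_mem_Ioo_zero_one] with t h ht
  have hw := Complex.slitPlane_ne_zero (one_sub_ofReal_mem_slitPlane ht)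
  have h1 := gaussFast_eq (c - a) (c - b) c t
  have h2 := one_sub_cpow_mul_gaussFast a b c hw
  have h3 := ordinaryHypergeometric_eq_one_sub_cpow_mul (a := c - a) (b := c - b) hc
    (norm_ofReal_lt_one ht)
  simp only [sub_sub_cancel] at h1 h3
  rw [show a - (c - b) = a + b - c by ring] at h1 h3
  rw [h3, h, h1, ← h2, Prod.fst_swap, Prod.snd_swap]
  ring

theorem HasGaussExpansion.snd_eq_Gamma {k : ℂ × ℂ} (hc : ∀ n : ℕ, c ≠ -(n : ℂ))
    (hs : Nonresonant a b c)
    (h : HasGaussExpansion a b c (fun t => ordinaryHypergeometric a b c (t : ℂ)) k) :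
    k.2 = Complex.Gamma c * Complex.Gamma (a + b - c) / (Complex.Gamma a * Complex.Gamma b) := by
  have := (h.swap hc).fst_eq_Gamma hc hs.swap
  simp only [sub_sub_cancel, Prod.fst_swap] at this
  rw [this, show a - (c - b) = a + b - c by ring]

end EulerTransformation

/-! ### Transfer to the radial equation -/

namespace HypergeometricSpectralProblem

variable {U : Set ℂ} (S : HypergeometricSpectralProblem U) {ω : ℂ}

/-- The factor `z ^ ρ₀ (1 - z) ^ ρ₁` removed from the radial equation. -/
noncomputable def prefactor (ω : ℂ) (z : ℝ) : ℂ := (z : ℂ) ^ S.ρ₀ ω * (1 - (z : ℂ)) ^ S.ρ₁ ω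

theorem prefactor_ne_zero {t : ℝ} (ht : t ∈ Ioo (0 : ℝ) 1) : S.prefactor ω t ≠ 0 := by
  have h0 : (t : ℂ) ≠ 0 := by exact_mod_cast ht.1.ne'
  have h1 := Complex.slitPlane_ne_zero (one_sub_ofReal_mem_slitPlane ht)
  simp [prefactor, Complex.cpow_eq_zero_iff, h0, h1]

theorem nonresonant_params (hω : ω ∈ U) : Nonresonant (S.a ω) (S.b ω) (S.c ω) :=
  S.nonresonant ω hω

theorem Rslow_eq (t : ℝ) :
    S.Rslow ω t = S.prefactor ω t * gaussSlow (S.a ω) (S.b ω) (S.c ω) t := rfl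

theorem Rfast_eq {t : ℝ} (ht : t ∈ Ioo (0 : ℝ) 1) :
    S.Rfast ω t = S.prefactor ω t * gaussFast (S.a ω) (S.b ω) (S.c ω) t := by
  have h1 := Complex.slitPlane_ne_zero (one_sub_ofReal_mem_slitPlane ht)
  rw [Rfast, prefactor, gaussFast, show S.ρ₁ ω + S.c ω - S.a ω - S.b ω =
    S.ρ₁ ω + (S.c ω - S.a ω - S.b ω) by ring, Complex.cpow_add _ _ h1]
  ring

theorem hasBoundaryExpansion_iff {R f : ℝ → ℂ} (hR : ∀ t ∈ Ioo (0 : ℝ) 1,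
    R t = S.prefactor ω t * f t) (k : ℂ × ℂ) :
    S.HasBoundaryExpansion ω R k ↔ HasGaussExpansion (S.a ω) (S.b ω) (S.c ω) f k := by
  refine eventually_congr ?_
  filter_upwards [eventually_mem_Ioo_zero_one] with t ht
  rw [hR t ht, S.Rslow_eq, S.Rfast_eq ht, ← mul_right_inj' (S.prefactor_ne_zero ht) (b := f t)]
  ring_nf

end HypergeometricSpectralProblem

theorem IsRadialSolution.congr {P Q f g : ℝ → ℂ} (hf : IsRadialSolution P Q f)
    (h : EqOn f g (Ioo 0 1)) : IsRadialSolution P Q g := by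
  intro t ht
  have h1 : g =ᶠ[𝓝 t] f := h.symm.eventuallyEq_of_mem (isOpen_Ioo.mem_nhds ht)
  obtain ⟨d1, d2, e⟩ := hf t ht
  refine ⟨d1.congr_of_eventuallyEq h1, d2.congr_of_eventuallyEq h1.deriv, ?_⟩
  rw [h1.deriv.deriv_eq, h1.deriv_eq, h1.self_of_nhds]
  exact e

theorem proposition1 {U : Set ℂ} (S : HypergeometricSpectralProblem U) (α β : ℂ)
    (hαβ : (α, β) ≠ (0, 0)) :
    (∀ ω ∈ U, IsRadialSolution (S.P ω) (S.Q ω) (S.Rin ω) ∧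
      ∀ Ψ : ℝ → ℂ, IsRadialSolution (S.P ω) (S.Q ω) Ψ →
        ∃! k : ℂ × ℂ, S.HasBoundaryExpansion ω Ψ k) ∧
    S.quasinormalFrequencies α β = {ω | ω ∈ U ∧ S.quantizationFunction α β ω = 0} := by
  have hin : ∀ ω ∈ U, IsRadialSolution (S.P ω) (S.Q ω) (S.Rin ω) := fun ω hω =>
    (S.reduces ω hω _).2
      (isHypergeometricSolution_ordinaryHypergeometric (S.c_ne_neg_nat ω hω))
  have hexp : ∀ ω ∈ U, ∀ Ψ : ℝ → ℂ, IsRadialSolution (S.P ω) (S.Q ω) Ψ →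
      ∃! k : ℂ × ℂ, S.HasBoundaryExpansion ω Ψ k := fun ω hω Ψ hΨ => by
    have hs := S.nonresonant_params hω
    have heq : ∀ t ∈ Ioo (0 : ℝ) 1,
        Ψ t = S.prefactor ω t * ((S.prefactor ω t)⁻¹ * Ψ t) := fun t ht =>
      (mul_inv_cancel_left₀ (S.prefactor_ne_zero ht) _).symm
    -- Dividing by the prefactor is legitimate only on $(0,1)$, but the equation sees a function
    -- only there.
    have hf := (S.reduces ω hω fun t => (S.prefactor ω t)⁻¹ * Ψ t).1 (hΨ.congr heq)
    obtain ⟨k, hk⟩ := hf.exists_hasGaussExpansion hs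
    refine ⟨k, (S.hasBoundaryExpansion_iff heq k).2 hk, fun l hl => ?_⟩
    exact ((S.hasBoundaryExpansion_iff heq l).1 hl).unique hs hk
  refine ⟨fun ω hω => ⟨hin ω hω, hexp ω hω⟩, ?_⟩
  ext ω
  refine and_congr_right fun hω => ?_
  -- The `epsilon` choice is a genuine expansion because one exists for the ingoing solution.
  have hk : S.HasBoundaryExpansion ω (S.Rin ω) (S.boundaryCoeffs ω (S.Rin ω)) :=
    Classical.epsilon_spec (hexp ω hω _ (hin ω hω)).exists
  have hg := (S.hasBoundaryExpansion_iff (fun t _ => rfl) _).1 hk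
  rw [HypergeometricSpectralProblem.boundaryFunctional,
    HypergeometricSpectralProblem.quantizationFunction,
    hg.fst_eq_Gamma (S.c_ne_neg_nat ω hω) (S.nonresonant_params hω),
    hg.snd_eq_Gamma (S.c_ne_neg_nat ω hω) (S.nonresonant_params hω)]
  rfl
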